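/- **Setting.** Let $m,n\ge 1$ be integers, let $\mathcal J=\{0,\dots,n-1\}^2$ index the entries of $n\times n$ arrays, and let operations on arrays be elementwise. For each $\xi\in\mathcal J$ let $(k_X,k_Y,k_Z)[\xi]\in\mathbb R^3$ be a unit vector with $k_Z[\xi]\ne-1$, and define real $n\times n$ arrays $$E_{XX}=1-\tfrac{k_X^2}{1+k_Z},\quad E_{XY}=E_{YX}=-\tfrac{k_Xk_Y}{1+k_Z},\quad E_{YY}=1-\tfrac{k_Y^2}{1+k_Z},\quad E_{XZ}=-k_X,\quad E_{YZ}=-k_Y .$$ Let $\mathcal I=\{XX,XY,XZ,YX,YY,YZ\}$ and $\mathcal H=(\mathbb C^{n\times n})^{\mathcal I}$; $\mathcal H$ and $\mathcal H^m$ carry the Euclidean (Frobenius) norm. Let $\mathcal F$ be the unitary two-dimensional discrete Fourier transform on $\mathbb C^{n\times n}$. Given phase diversities $\phi_d\in\mathbb R^{n\times n}$ and data $r_d\in\mathbb R^{n\times n}$ $(d=1,\dots,m)$, put, for $x=(x_c)_{c\in\mathcal I}\in\mathcal H$, $$M_d(x)=\big(\mathcal F(x_c\cdot e^{\mathrm j\phi_d})\big)_{c\in\mathcal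 I},\qquad \mathcal G_d(x)=\sqrt{\textstyle\sum_{c\in\mathcal I}|M_d(x)_c|^2},$$ $$\Omega_0=\{(E_c\cdot z)_{c\in\mathcal I} : z\in\mathbb C^{n\times n}\},\qquad \Omega_d=\Big\{x\in\mathcal H : \sum_{c\in\mathcal I}\big|\mathcal F(x_c\cdot e^{\mathrm j\phi_d})\big|^2=r_d\Big\},$$ $$[x]_m=(x,\dots,x)\in\mathcal H^m,\qquad A=\{[x]_m : x\in\Omega_0\}\subset\mathcal H^m,\qquad B=\Omega_1\times\cdots\times\Omega_m\subset\mathcal H^m .$$ For a set $\Omega$ let $P_\Omega(x)=\{w\in\Omega:\|x-w\|=\operatorname{dist}(x,\Omega)\}$ (set-valued), let $T_{AP}=P_AP_B$, and for a set-valued mapping $T$ let $\operatorname{Fix}T=\{x: x\in T(x)\}$. * $T$ is *almost averaged* on a set $U$ with violation $\varepsilon$ and averaging constant $\alpha$ if for all $y,z\in U$, $y^+\in T(y)$, $z^+\in T(z)$: $\|z^+-y^+\|^2\le(1+\varepsilon)\|z-y\|^2-\frac{1-\alpha}{\alpha}\|(z^+-z)-(y^+-y)\|^2$. * A set-valued mapping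 $\Theta$ is *metrically subregular at $\hat x\in\Theta^{-1}(\hat y)$ for $\hat y$ relative to $\Lambda$ with modulus $\kappa>0$* if there is a neighborhood $U$ of $\hat x$ with $\kappa\operatorname{dist}(x,\Theta^{-1}(\hat y)\cap\Lambda)\le\operatorname{dist}(\hat y,\Theta(x))$ for all $x\in U\cap\Lambda$. **Statement.** Suppose $A\cap B\neq\emptyset$, and let $\hat{\mathbf a}=[\hat x]_m\in A\cap B$ with $\mathcal G_d(\hat x)$ nonzero in every entry for every $d=1,\dots,m$. Then for every $\varepsilon>0$ there is $\delta>0$ such that $T_{AP}$ is almost averaged on the open ball $\mathbb B_\delta(\hat{\mathbf a})$ with violation $\varepsilon$ and averaging constant $2/3$ and the following holds for every $\kappa>\sqrt{2\varepsilon}$: if $\mathrm{Id}-T_{AP}$ is metrically subregular at $\hat{\mathbf a}$ for $0$ relative to $A$ with modulus $\kappa$, then, with $$c=\sqrt{1+\varepsilon-\kappa^2/2}<1,$$ every sequence $(x_k)$ with $x_0\in A\cap\mathbb B_\delta(\hat{\mathbf a})$ and $x_{k+1}\in T_{AP}(x_k)$ for all $k$ converges linearly with rate at most $c$ to some point $p\in\operatorname{Fix}T_{AP}$;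 that is, $0<c<1$ and there is $\gamma>0$ with $\|x_k-p\|\le\gamma c^k$ for all $k\in\mathbb N$. -/

import Mathlib

open scoped Topology

noncomputable section

namespace HighNA

/-! ### Projectors, fixed points and regularity of set-valued mappings -/

section SetValued

variable {X : Type*} [NormedAddCommGroup X]

/-- The projector `P_Ω(x) = {w ∈ Ω | ‖x - w‖ = dist(x, Ω)}` (a set-valued mapping). -/
def projector (Ω : Set X) (x : X) : Set X :=
  {w | w ∈ Ω ∧ ‖x - w‖ = Metric.infDist x Ω}

/-- The alternating projection operator `P_A P_B` (composition of set-valued mappings). -/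
def TAP (A B : Set X) (u : X) : Set X :=
  {v | ∃ w ∈ projector B u, v ∈ projector A w}

/-- `Fix T = {x | x ∈ T(x)}`. -/
def fixSet (T : X → Set X) : Set X :=
  {x | x ∈ T x}

/-- The set-valued mapping `Id - T`. -/
def idSub (T : X → Set X) (x : X) : Set X :=
  {y | ∃ v ∈ T x, y = x - v}

/-- `T` is pointwise almost averaged at `y` on `Ω` with violation `ε` and averaging
constant `α`. -/
def PointwiseAlmostAveraged (T : X → Set X) (y : X) (Ω : Set X) (ε α : ℝ) : Prop :=
  ∀ y' ∈ T y, ∀ z ∈ Ω, ∀ z' ∈ T z,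
    ‖z' - y'‖ ^ 2 ≤ (1 + ε) * ‖z - y‖ ^ 2 - (1 - α) / α * ‖(z' - z) - (y' - y)‖ ^ 2

/-- `T` is almost averaged on `Ω`: pointwise almost averaged at every point of `Ω`. -/
def AlmostAveragedOn (T : X → Set X) (Ω : Set X) (ε α : ℝ) : Prop :=
  ∀ y ∈ Ω, PointwiseAlmostAveraged T y Ω ε α

/-- `Θ` is metrically subregular on `U` for `y` relative to `Λ` with modulus `κ > 0`:
`κ dist(x, Θ⁻¹(y) ∩ Λ) ≤ dist(y, Θ(x))` for all `x ∈ U ∩ Λ`. -/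
def MetricallySubregularOn (Θ : X → Set X) (U : Set X) (y : X) (Λ : Set X) (κ : ℝ) : Prop :=
  0 < κ ∧ ∀ x ∈ U ∩ Λ,
    κ * Metric.infDist x ({x' | y ∈ Θ x'} ∩ Λ) ≤ Metric.infDist y (Θ x)

/-- `Θ` is metrically subregular at `x ∈ Θ⁻¹(y)` for `y` relative to `Λ` with modulus `κ`:
the property holds on some neighborhood of `x`. -/
def MetricallySubregularAt (Θ : X → Set X) (x y : X) (Λ : Set X) (κ : ℝ) : Prop :=
  y ∈ Θ x ∧ ∃ U ∈ 𝓝 x, MetricallySubregularOn Θ U y Λ κ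

/-- An iterative sequence generated by `T`. -/
def IsIterativeSequence (T : X → Set X) (x : ℕ → X) : Prop :=
  ∀ k, x (k + 1) ∈ T (x k)

/-- `x k` converges linearly to `p` with rate (at most) `c ∈ (0, 1)`. -/
def ConvergesLinearly (x : ℕ → X) (p : X) (c : ℝ) : Prop :=
  0 < c ∧ c < 1 ∧ ∃ γ > 0, ∀ k, ‖x k - p‖ ≤ γ * c ^ k

end SetValued

/-! ### The imaging model -/

/-- The index set `{XX, XY, XZ, YX, YY, YZ}`. -/
inductive Component where
  | XX | XY | XZ | YX | YY | YZ
  deriving DecidableEq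

instance : Fintype Component where
  elems := {.XX, .XY, .XZ, .YX, .YY, .YZ}
  complete c := by cases c <;> simp

/-- Pixels of an `n × n` array. -/
abbrev Pixel (n : ℕ) : Type := Fin n × Fin n

/-- `ℂ^{n×n}` with the Frobenius norm. -/
abbrev Img (n : ℕ) : Type := EuclideanSpace ℂ (Pixel n)

/-- The underlying space: six copies of `ℂ^{n×n}`, with its Hilbert (Frobenius) norm. -/
abbrev HSpace (n : ℕ) : Type := PiLp 2 (fun _ : Component => Img n)

/-- The product space of `m` copies of the underlying space, with its Hilbert norm. -/
abbrev HProd (m n : ℕ) : Type := PiLp 2 (fun _ : Fin m => HSpace n)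

/-- The six amplitude modulations `E_c`, determined by the wave vector `(kX, kY, kZ)` at each
pixel. -/
def modulation {n : ℕ} (kX kY kZ : Pixel n → ℝ) : Component → Pixel n → ℝ
  | .XX, ξ => 1 - kX ξ ^ 2 / (1 + kZ ξ)
  | .XY, ξ => -(kX ξ * kY ξ / (1 + kZ ξ))
  | .XZ, ξ => -kX ξ
  | .YX, ξ => -(kY ξ * kX ξ / (1 + kZ ξ))
  | .YY, ξ => 1 - kY ξ ^ 2 / (1 + kZ ξ)
  | .YZ, ξ => -kY ξ

/-- The unitary two-dimensional discrete Fourier transform on `ℂ^{n×n}`. -/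
def dft2 {n : ℕ} (x : Img n) : Img n :=
  WithLp.toLp 2 fun η => (1 / (n : ℂ)) * ∑ ξ : Pixel n, x ξ *
    Complex.exp (-(2 * Real.pi * Complex.I *
      ((ξ.1 : ℂ) * (η.1 : ℂ) + (ξ.2 : ℂ) * (η.2 : ℂ)) / n))

/-- `M_φ(x) = (F(x_c · e^{jφ}))_c` for a phase diversity `φ`. -/
def phaseFourier {n : ℕ} (φ : Pixel n → ℝ) (x : HSpace n) : HSpace n :=
  WithLp.toLp 2 fun c =>
    dft2 (WithLp.toLp 2 fun ξ => x c ξ * Complex.exp (Complex.I * φ ξ))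

/-- `G_φ(x) = √(∑_c |M_φ(x)_c|²)`, elementwise. -/
def gMag {n : ℕ} (φ : Pixel n → ℝ) (x : HSpace n) (ξ : Pixel n) : ℝ :=
  Real.sqrt (∑ c, ‖phaseFourier φ x c ξ‖ ^ 2)

/-- The linear subspace `Ω₀ = {(E_c · z)_c | z ∈ ℂ^{n×n}}`. -/
def omegaZero {n : ℕ} (E : Component → Pixel n → ℝ) : Set (HSpace n) :=
  {x | ∃ z : Img n, x = WithLp.toLp 2 fun c => WithLp.toLp 2 fun ξ => (E c ξ : ℂ) * z ξ}

/-- The intensity constraint set `{x | ∑_c |F(x_c · e^{jφ})|² = r}` (elementwise equality). -/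
def omegaInt {n : ℕ} (φ r : Pixel n → ℝ) : Set (HSpace n) :=
  {x | ∀ ξ, ∑ c, ‖phaseFourier φ x c ξ‖ ^ 2 = r ξ}

/-- `[x]_m = (x, …, x)`. -/
def dup (m : ℕ) {n : ℕ} (x : HSpace n) : HProd m n :=
  WithLp.toLp 2 fun _ => x

/-- `A = {[x]_m | x ∈ Ω₀}`. -/
def setA (m : ℕ) {n : ℕ} (E : Component → Pixel n → ℝ) : Set (HProd m n) :=
  dup m '' omegaZero E

/-- `B = Ω₁ × ⋯ × Ω_m`. -/
def setB {m n : ℕ} (φ r : Fin m → Pixel n → ℝ) : Set (HProd m n) :=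
  {u | ∀ d, u d ∈ omegaInt (φ d) (r d)}

end HighNA

end

/-!
The theorem separates into a local geometric estimate and an abstract convergence principle.

The coordinates of `HProd m n` regrouped by image plane and pixel, after phase modulation and the
unitary Fourier transform, form a linear isometry `measurementIso` onto a product of copies of
`ℂ⁶`. Through it `B` is a product of spheres whose radii, the entries of `G_d(xhat)`, are all
positive, while `A` is a linear subspace. Off the centres the projection onto a product of spheres
is radial in every block, and near the spheres the radial projection violates firm nonexpansiveness
by an arbitrarily small amount (`radial_almost_firm`). Composed with the firmly nonexpansive
projection onto `A` this gives almost averagedness with constant `2 / 3` and any violation on a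
small enough ball (`exists_almostAveragedOn_TAP`).

Let `S` be the set of fixed points in `A`. Almost averagedness against points of `S`, together with
metric subregularity, gives `dist(x⁺, S) ≤ √(1 + ε - κ² / 2) dist(x, S)` and
`‖x⁺ - x‖ ≤ √(2 (1 + ε)) dist(x, S)`, so iterates started close enough to the reference point remain
where these estimates hold and converge linearly; the limit is a fixed point since almost
averagedness makes the mapping single-valued and continuous
(`exists_ball_linear_convergence`).

Two points need more care. The ball must not depend on `κ`, although the neighbourhood of
subregularity does: a nearly optimal modulus `κ₀` is fixed first, and using violation `ε / 2` instead
of `ε` covers the gap to every other admissible `κ`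
(`exists_uniform_ball_linear_convergence`). And the rate must be positive, that is
`κ ^ 2 < 2 * (1 + ε)`: the points `(1 + t) • a` of the ray through the reference point `a` lie in `A`
and are all mapped to `a`, so subregularity cannot hold with a larger modulus
(`sq_lt_of_metricallySubregularAt`).
-/

namespace HighNA

/-! ### Linear convergence of almost averaged mappings -/

section Convergence

variable {X : Type*} [NormedAddCommGroup X]

theorem zero_mem_idSub {T : X → Set X} {x : X} : 0 ∈ idSub T x ↔ x ∈ T x := by
  constructor
  · rintro ⟨v, hv, h⟩
    have hxv : x = v := sub_eq_zero.1 h.symm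
    exact hxv ▸ hv
  · exact fun h => ⟨x, h, (sub_self x).symm⟩

theorem infDist_idSub_le {T : X → Set X} {x x' : X} (h : x' ∈ T x) :
    Metric.infDist 0 (idSub T x) ≤ ‖x' - x‖ := by
  have := Metric.infDist_le_dist_of_mem (x := (0 : X)) (s := idSub T x) ⟨x', h, rfl⟩
  rwa [dist_zero_left, norm_sub_rev] at this

/-- The averaging inequality against a fixed point, whose own displacement vanishes. -/
theorem AlmostAveragedOn.fixed {T : X → Set X} {Ω : Set X} {ε : ℝ}
    (h : AlmostAveragedOn T Ω ε (2 / 3)) {s z z' : X} (hs : s ∈ T s) (hsΩ : s ∈ Ω)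
    (hz : z ∈ Ω) (hz' : z' ∈ T z) :
    ‖z' - s‖ ^ 2 + 1 / 2 * ‖z' - z‖ ^ 2 ≤ (1 + ε) * ‖z - s‖ ^ 2 := by
  have := h s hsΩ s hs z hz z' hz'
  rw [sub_self, sub_zero] at this
  linarith

theorem AlmostAveragedOn.mono {T : X → Set X} {Ω Ω' : Set X} {ε ε' α : ℝ}
    (h : AlmostAveragedOn T Ω ε α) (hΩ : Ω' ⊆ Ω) (hε : ε ≤ ε') :
    AlmostAveragedOn T Ω' ε' α := by
  intro y hy y' hy' z hz z' hz'
  have h1 := h y (hΩ hy) y' hy' z (hΩ hz) z' hz'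
  have h2 : ε * ‖z - y‖ ^ 2 ≤ ε' * ‖z - y‖ ^ 2 := by gcongr
  linarith

/-- The averaging inequality with the distances to a fixed point replaced by the distances to the
set of fixed points, which need not be attained. -/
theorem AlmostAveragedOn.infDist_fixed {T : X → Set X} {S : Set X} {a x x' : X} {R ε : ℝ}
    (hε : 0 ≤ ε) (hav : AlmostAveragedOn T (Metric.ball a R) ε (2 / 3))
    (haS : a ∈ S) (hS : ∀ s ∈ S, s ∈ T s) (hx : ‖x - a‖ < R / 3) (hx' : x' ∈ T x) :
    Metric.infDist x' S ^ 2 + 1 / 2 * ‖x' - x‖ ^ 2 ≤ (1 + ε) * Metric.infDist x S ^ 2 := by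
  have hR : 0 < R / 3 := (norm_nonneg _).trans_lt hx
  have hD : Metric.infDist x S ≤ ‖x - a‖ := by
    rw [← dist_eq_norm]; exact Metric.infDist_le_dist_of_mem haS
  have hlim : Filter.Tendsto (fun η : ℝ => (1 + ε) * (Metric.infDist x S + η) ^ 2) (𝓝[>] 0)
      (𝓝 ((1 + ε) * (Metric.infDist x S + 0) ^ 2)) :=
    (Continuous.tendsto (by fun_prop) 0).mono_left nhdsWithin_le_nhds
  rw [add_zero] at hlim
  refine ge_of_tendsto hlim ?_
  filter_upwards [Ioo_mem_nhdsGT hR] with η hη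
  obtain ⟨s, hs, hxs⟩ := (Metric.infDist_lt_iff ⟨a, haS⟩).1 (lt_add_of_pos_right
    (Metric.infDist x S) hη.1)
  rw [dist_eq_norm] at hxs
  have hsa : ‖s - a‖ < R := by
    have := norm_sub_le_norm_sub_add_norm_sub s x a
    rw [norm_sub_rev s x] at this
    linarith [hη.2]
  have h1 := hav.fixed (hS s hs) (mem_ball_iff_norm.2 hsa)
    (mem_ball_iff_norm.2 (by linarith)) hx'
  have h2 : Metric.infDist x' S ≤ ‖x' - s‖ := by
    rw [← dist_eq_norm]; exact Metric.infDist_le_dist_of_mem hs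
  have h3 : Metric.infDist x' S ^ 2 ≤ ‖x' - s‖ ^ 2 :=
    pow_le_pow_left₀ Metric.infDist_nonneg h2 2
  have h4 : ‖x - s‖ ^ 2 ≤ (Metric.infDist x S + η) ^ 2 :=
    pow_le_pow_left₀ (norm_nonneg _) hxs.le 2
  have h5 : (1 + ε) * ‖x - s‖ ^ 2 ≤ (1 + ε) * (Metric.infDist x S + η) ^ 2 := by gcongr
  linarith

/-- Almost averagedness and metric subregularity make the distance to the fixed points contract by
the factor `√(1 + ε - κ² / 2)`; the steps are then dominated by a geometric series, which traps the
iterates near `a` and forces them to converge. -/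
theorem exists_ball_linear_convergence [CompleteSpace X] {T : X → Set X} {A : Set X} {a : X}
    {R ε κ : ℝ} (hR : 0 < R) (hε : 0 ≤ ε) (hT : ∀ x, (T x).Nonempty) (hTA : ∀ x, T x ⊆ A)
    (hav : AlmostAveragedOn T (Metric.ball a R) ε (2 / 3))
    (hsub : MetricallySubregularAt (idSub T) a 0 A κ) (hq : 1 + ε - κ ^ 2 / 2 < 1) :
    ∃ δ > 0, ∀ x : ℕ → X, IsIterativeSequence T x → x 0 ∈ A ∩ Metric.ball a δ →
      ∃ p ∈ fixSet T, ∃ γ > 0, ∀ k, ‖x k - p‖ ≤ γ * Real.sqrt (1 + ε - κ ^ 2 / 2) ^ k := by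
  obtain ⟨ha, U, hU, hκ, hUA⟩ := hsub
  set S : Set X := {x' | 0 ∈ idSub T x'} ∩ A with hSdef
  have haT : a ∈ T a := zero_mem_idSub.1 ha
  have haS : a ∈ S := ⟨ha, hTA a haT⟩
  have hS : ∀ s ∈ S, s ∈ T s := fun s hs => zero_mem_idSub.1 hs.1
  obtain ⟨ρ, hρ, hρU⟩ := Metric.mem_nhds_iff.1 hU
  set R' : ℝ := min ρ (R / 3) with hR'def
  have hR' : 0 < R' := lt_min hρ (by positivity)
  set c : ℝ := Real.sqrt (1 + ε - κ ^ 2 / 2) with hc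
  have hc0 : 0 ≤ c := Real.sqrt_nonneg _
  have hc1 : c < 1 := by rw [hc, Real.sqrt_lt' one_pos]; linarith
  set C : ℝ := Real.sqrt (2 * (1 + ε)) with hC
  have hC0 : 0 ≤ C := Real.sqrt_nonneg _
  have step : ∀ x ∈ A, ‖x - a‖ < R' → ∀ x' ∈ T x,
      Metric.infDist x' S ≤ c * Metric.infDist x S ∧ ‖x' - x‖ ≤ C * Metric.infDist x S := by
    intro x hxA hx x' hx'
    have h1 := hav.infDist_fixed hε haS hS (hx.trans_le (min_le_right _ _)) hx'
    have h2 : κ * Metric.infDist x S ≤ ‖x' - x‖ :=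
      (hUA x ⟨hρU (mem_ball_iff_norm.2 (hx.trans_le (min_le_left _ _))), hxA⟩).trans
        (infDist_idSub_le hx')
    have hD : 0 ≤ Metric.infDist x S := Metric.infDist_nonneg
    have h3 : (κ * Metric.infDist x S) ^ 2 ≤ ‖x' - x‖ ^ 2 :=
      pow_le_pow_left₀ (by positivity) h2 2
    rw [mul_pow] at h3
    constructor
    · have : Metric.infDist x' S ≤
          Real.sqrt ((1 + ε - κ ^ 2 / 2) * Metric.infDist x S ^ 2) := by
        apply Real.le_sqrt_of_sq_le
        linarith
      rwa [Real.sqrt_mul' _ (sq_nonneg _), Real.sqrt_sq hD] at this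
    · have : ‖x' - x‖ ≤ Real.sqrt (2 * (1 + ε) * Metric.infDist x S ^ 2) := by
        apply Real.le_sqrt_of_sq_le
        linarith [sq_nonneg (Metric.infDist x' S)]
      rwa [Real.sqrt_mul' _ (sq_nonneg _), Real.sqrt_sq hD] at this
  have h1c : 0 < 1 - c := by linarith
  have hden : 0 < 1 + C / (1 - c) := by positivity
  refine ⟨R' / (1 + C / (1 - c)), by positivity, fun x hx hx0 => ?_⟩
  have hx0δ : ‖x 0 - a‖ < R' / (1 + C / (1 - c)) := mem_ball_iff_norm.1 hx0.2
  rw [lt_div_iff₀ hden] at hx0δ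
  set D : ℝ := Metric.infDist (x 0) S with hD
  have hD0 : 0 ≤ D := Metric.infDist_nonneg
  have hDa : D ≤ ‖x 0 - a‖ := by
    rw [← dist_eq_norm]; exact Metric.infDist_le_dist_of_mem haS
  set M : ℝ := C * D / (1 - c) with hM
  have hM0 : 0 ≤ M := by positivity
  have hMc : M * (1 - c) = C * D := div_mul_cancel₀ _ h1c.ne'
  have hMR : ‖x 0 - a‖ + M < R' := by
    refine lt_of_le_of_lt ?_ hx0δ
    have : M ≤ C / (1 - c) * ‖x 0 - a‖ := by
      rw [hM, mul_div_right_comm]; gcongr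
    linarith
  -- `M * (1 - c ^ k)` is the sum of the first `k` terms of the geometric series bounding the steps.
  have key : ∀ k, x k ∈ A ∧ Metric.infDist (x k) S ≤ D * c ^ k ∧
      ‖x k - a‖ ≤ ‖x 0 - a‖ + M * (1 - c ^ k) := by
    intro k
    induction k with
    | zero => exact ⟨hx0.1, by simp [hD], by simp⟩
    | succ k ih =>
      obtain ⟨hA, hd, hn⟩ := ih
      have hlt : ‖x k - a‖ < R' := by
        have : 0 ≤ M * c ^ k := by positivity
        linarith
      obtain ⟨h1, h2⟩ := step (x k) hA hlt _ (hx k)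
      refine ⟨hTA _ (hx k), ?_, ?_⟩
      · calc _ ≤ c * Metric.infDist (x k) S := h1
          _ ≤ c * (D * c ^ k) := by gcongr
          _ = _ := by ring
      · have h3 : ‖x (k + 1) - x k‖ ≤ C * (D * c ^ k) := h2.trans (by gcongr)
        have h4 := norm_sub_le_norm_sub_add_norm_sub (x (k + 1)) (x k) a
        have h5 : C * (D * c ^ k) = M * (c ^ k - c ^ (k + 1)) := by
          rw [pow_succ]; linear_combination -(c ^ k) * hMc
        linarith
  have hball : ∀ k, ‖x k - a‖ ≤ ‖x 0 - a‖ + M := by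
    intro k
    have : 0 ≤ M * c ^ k := by positivity
    linarith [(key k).2.2]
  have hdist : ∀ k, dist (x k) (x (k + 1)) ≤ C * D * c ^ k := by
    intro k
    rw [dist_comm, dist_eq_norm]
    calc _ ≤ C * Metric.infDist (x k) S :=
          (step (x k) (key k).1 ((hball k).trans_lt hMR) _ (hx k)).2
      _ ≤ C * (D * c ^ k) := by gcongr; exact (key k).2.1
      _ = _ := by ring
  obtain ⟨p, hp⟩ := cauchySeq_tendsto_of_complete (cauchySeq_of_le_geometric c _ hc1 hdist)
  have hrate := dist_le_of_le_geometric_of_tendsto c _ hc1 hdist hp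
  have hR'R : R' < R := (min_le_right _ _).trans_lt (by linarith)
  have hpa : ‖p - a‖ < R := by
    refine (le_of_tendsto (hp.sub_const a).norm (Filter.Eventually.of_forall hball)).trans_lt ?_
    exact hMR.trans hR'R
  refine ⟨p, ?_, M + 1, by positivity, fun k => ?_⟩
  · -- Almost averagedness makes `T` single-valued and continuous at `p`.
    obtain ⟨p', hp'⟩ := hT p
    have h1 : ∀ k, ‖x (k + 1) - p'‖ ^ 2 ≤ (1 + ε) * ‖x k - p‖ ^ 2 := by
      intro k
      have := hav p (mem_ball_iff_norm.2 hpa) p' hp' (x k)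
        (mem_ball_iff_norm.2 (((hball k).trans_lt hMR).trans hR'R)) _ (hx k)
      have h0 : 0 ≤ (1 - 2 / 3 : ℝ) / (2 / 3) * ‖x (k + 1) - x k - (p' - p)‖ ^ 2 := by
        have : (0 : ℝ) ≤ (1 - 2 / 3 : ℝ) / (2 / 3) := by norm_num
        positivity
      linarith
    have h2 := le_of_tendsto_of_tendsto'
      ((((Filter.tendsto_add_atTop_iff_nat 1).2 hp).sub_const p').norm.pow 2)
      (((hp.sub_const p).norm.pow 2).const_mul (1 + ε)) h1
    have h3 : ‖p - p'‖ ^ 2 = 0 := by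
      refine le_antisymm ?_ (sq_nonneg _)
      simpa using h2
    have h4 : p = p' := by simpa [sub_eq_zero] using h3
    rw [← h4] at hp'
    exact hp'
  · have h1 := hrate k
    rw [dist_eq_norm] at h1
    have h2 : C * D * c ^ k / (1 - c) = M * c ^ k := by rw [hM]; ring
    have h3 : 0 ≤ c ^ k := by positivity
    linarith

/-- The rate `√(1 + ε - κ² / 2)` is never degenerate when some ray through `a` is mapped back to
`a`: a modulus with `2 * (1 + ε) ≤ κ ^ 2` would force the points of the ray near `a` to be strictly
closer to the set of fixed points than to `a`, and the averaging inequality excludes this. -/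
theorem sq_lt_of_metricallySubregularAt [NormedSpace ℝ X] {T : X → Set X} {A : Set X} {a : X}
    {R ε κ : ℝ} (hR : 0 < R) (hε : 0 ≤ ε)
    (hav : AlmostAveragedOn T (Metric.ball a R) ε (2 / 3)) (hTA : ∀ x, T x ⊆ A)
    (ha0 : a ≠ 0) (hray : ∀ t : ℝ, 0 < t → (1 + t) • a ∈ A ∧ a ∈ T ((1 + t) • a))
    (hsub : MetricallySubregularAt (idSub T) a 0 A κ) : κ ^ 2 < 2 * (1 + ε) := by
  obtain ⟨ha, U, hU, hκ, hUA⟩ := hsub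
  by_contra! hcon
  set S : Set X := {x' | 0 ∈ idSub T x'} ∩ A with hSdef
  have haT : a ∈ T a := zero_mem_idSub.1 ha
  have haS : a ∈ S := ⟨ha, hTA a haT⟩
  have hκ1 : 1 < κ := by nlinarith
  obtain ⟨ρ, hρ, hρU⟩ := Metric.mem_nhds_iff.1 hU
  have hN : 0 < ‖a‖ := norm_pos_iff.2 ha0
  set h : ℝ := min ρ (R / 3) / 2 with hh
  have hmin : 0 < min ρ (R / 3) := lt_min hρ (by positivity)
  have hpos : 0 < h := by positivity
  have hhρ : h < ρ := by linarith [min_le_left ρ (R / 3)]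
  have hhR : h < R / 3 := by linarith [min_le_right ρ (R / 3)]
  set u : X := (1 + h / ‖a‖) • a with hu
  obtain ⟨huA, hau⟩ := hray (h / ‖a‖) (by positivity)
  have hua : ‖u - a‖ = h := by
    rw [hu, add_smul, one_smul, add_sub_cancel_left, norm_smul, Real.norm_of_nonneg (by positivity),
      div_mul_cancel₀ _ hN.ne']
  set D : ℝ := Metric.infDist u S with hD
  have hD0 : 0 ≤ D := Metric.infDist_nonneg
  have hκD : κ * D ≤ h := by
    rw [← hua, norm_sub_rev]
    exact (hUA u ⟨hρU (mem_ball_iff_norm.2 (by rwa [hua])), huA⟩).trans (infDist_idSub_le hau)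
  have hDh : D < h := by
    by_contra! hge
    nlinarith
  have hlim1 : Filter.Tendsto (fun η : ℝ => 1 / 2 * h ^ 2 + (h - (D + η)) ^ 2) (𝓝[>] 0)
      (𝓝 (1 / 2 * h ^ 2 + (h - (D + 0)) ^ 2)) :=
    (Continuous.tendsto (by fun_prop) 0).mono_left nhdsWithin_le_nhds
  have hlim2 : Filter.Tendsto (fun η : ℝ => (1 + ε) * (D + η) ^ 2) (𝓝[>] 0)
      (𝓝 ((1 + ε) * (D + 0) ^ 2)) :=
    (Continuous.tendsto (by fun_prop) 0).mono_left nhdsWithin_le_nhds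
  have hle := le_of_tendsto_of_tendsto hlim1 hlim2 (by
    filter_upwards [Ioo_mem_nhdsGT (show 0 < h - D by linarith)] with η hη
    obtain ⟨s, hs, hus⟩ := (Metric.infDist_lt_iff ⟨a, haS⟩).1 (lt_add_of_pos_right D hη.1)
    rw [dist_eq_norm] at hus
    have htri := norm_sub_le_norm_sub_add_norm_sub s u a
    rw [norm_sub_rev s u, hua] at htri
    have htri' := norm_sub_le_norm_sub_add_norm_sub u s a
    rw [hua, norm_sub_rev s a] at htri'
    have h1 := hav.fixed (zero_mem_idSub.1 hs.1)
      (mem_ball_iff_norm.2 (by linarith [hη.2])) (z := u)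
      (mem_ball_iff_norm.2 (by linarith)) hau
    rw [norm_sub_rev a u, hua] at h1
    have h2 : (h - (D + η)) ^ 2 ≤ ‖a - s‖ ^ 2 :=
      pow_le_pow_left₀ (by linarith [hη.2]) (by linarith) 2
    have h3 : (1 + ε) * ‖u - s‖ ^ 2 ≤ (1 + ε) * (D + η) ^ 2 := by gcongr
    linarith)
  rw [add_zero] at hle
  have h4 : (κ * D) ^ 2 ≤ h ^ 2 := pow_le_pow_left₀ (by positivity) hκD 2
  have h5 : 2 * (1 + ε) * D ^ 2 ≤ κ ^ 2 * D ^ 2 := by gcongr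
  have h6 : 0 < (h - D) ^ 2 := by
    have : 0 < h - D := by linarith
    positivity
  rw [mul_pow] at h4
  linarith

/-- One radius serves all moduli `κ`, although the neighbourhood of subregularity depends on `κ`:
the admissible moduli are bounded, so a nearly optimal one `κ₀` can be fixed in advance, and the
loss in passing from `κ` to `κ₀` is absorbed by using almost averagedness with violation `ε / 2`. -/
theorem exists_uniform_ball_linear_convergence [NormedSpace ℝ X] [CompleteSpace X]
    {T : X → Set X} {A : Set X} {a : X} (hT : ∀ x, (T x).Nonempty) (hTA : ∀ x, T x ⊆ A)
    (hav : ∀ ε > 0, ∃ R > 0, AlmostAveragedOn T (Metric.ball a R) ε (2 / 3))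
    (ha0 : a ≠ 0) (hray : ∀ t : ℝ, 0 < t → (1 + t) • a ∈ A ∧ a ∈ T ((1 + t) • a))
    {ε : ℝ} (hε : 0 < ε) :
    ∃ δ > 0, AlmostAveragedOn T (Metric.ball a δ) ε (2 / 3) ∧
      ∀ κ : ℝ, Real.sqrt (2 * ε) < κ → MetricallySubregularAt (idSub T) a 0 A κ →
        Real.sqrt (1 + ε - κ ^ 2 / 2) < 1 ∧
        ∀ x : ℕ → X, IsIterativeSequence T x → x 0 ∈ A ∩ Metric.ball a δ →
          ∃ p ∈ fixSet T, ConvergesLinearly x p (Real.sqrt (1 + ε - κ ^ 2 / 2)) := by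
  obtain ⟨R, hR, hav2⟩ := hav (ε / 2) (by positivity)
  have hav1 : AlmostAveragedOn T (Metric.ball a R) ε (2 / 3) := hav2.mono subset_rfl (by linarith)
  set K : Set ℝ := {κ | Real.sqrt (2 * ε) < κ ∧ MetricallySubregularAt (idSub T) a 0 A κ} with hK
  have hKpos : ∀ κ ∈ K, 2 * ε < κ ^ 2 := fun κ hκ =>
    (Real.sqrt_lt' ((Real.sqrt_nonneg _).trans_lt hκ.1)).1 hκ.1
  have hKbd : ∀ κ ∈ K, κ ^ 2 < 2 * (1 + ε) := fun κ hκ =>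
    sq_lt_of_metricallySubregularAt hR hε.le hav1 hTA ha0 hray hκ.2
  rcases K.eq_empty_or_nonempty with hemp | hne
  · refine ⟨R, hR, hav1, fun κ h1 h2 => ?_⟩
    have : κ ∈ K := ⟨h1, h2⟩
    simp [hemp] at this
  obtain ⟨κ₀, hκ₀, hopt⟩ : ∃ κ₀ ∈ K, ∀ κ ∈ K, κ ^ 2 ≤ κ₀ ^ 2 + ε := by
    have hbdd : BddAbove ((fun κ : ℝ => κ ^ 2) '' K) := by
      refine ⟨2 * (1 + ε), ?_⟩
      rintro _ ⟨κ, hκ, rfl⟩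
      exact (hKbd κ hκ).le
    obtain ⟨_, ⟨κ₀, hκ₀, rfl⟩, hlt⟩ := exists_lt_of_lt_csSup (hne.image _)
      (sub_lt_self (sSup ((fun κ : ℝ => κ ^ 2) '' K)) hε)
    refine ⟨κ₀, hκ₀, fun κ hκ => ?_⟩
    have := le_csSup hbdd ⟨κ, hκ, rfl⟩
    simp only at this hlt
    linarith
  obtain ⟨δ, hδ, hconv⟩ := exists_ball_linear_convergence hR (by positivity : 0 ≤ ε / 2) hT hTA
    hav2 hκ₀.2 (by linarith [hKpos κ₀ hκ₀])
  refine ⟨min R δ, lt_min hR hδ,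
    hav1.mono (Metric.ball_subset_ball (min_le_left _ _)) le_rfl, fun κ h1 h2 => ?_⟩
  have hκ : κ ∈ K := ⟨h1, h2⟩
  have hlt : Real.sqrt (1 + ε - κ ^ 2 / 2) < 1 := by
    rw [Real.sqrt_lt' one_pos]; linarith [hKpos κ hκ]
  refine ⟨hlt, fun x hx hx0 => ?_⟩
  obtain ⟨p, hp, γ, hγ, hb⟩ :=
    hconv x hx ⟨hx0.1, Metric.ball_subset_ball (min_le_right _ _) hx0.2⟩
  refine ⟨p, hp, Real.sqrt_pos.2 (by linarith [hKbd κ hκ]), hlt, γ, hγ, fun k => (hb k).trans ?_⟩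
  have : Real.sqrt (1 + ε / 2 - κ₀ ^ 2 / 2) ≤ Real.sqrt (1 + ε - κ ^ 2 / 2) :=
    Real.sqrt_le_sqrt (by linarith [hopt κ hκ])
  gcongr

end Convergence

/-! ### Projections onto subspaces and products of spheres -/

section Projector

variable {X : Type*} [NormedAddCommGroup X]

theorem projector_nonempty [ProperSpace X] {Ω : Set X} (hc : IsClosed Ω) (hne : Ω.Nonempty)
    (x : X) : (projector Ω x).Nonempty := by
  obtain ⟨w, hw, h⟩ := hc.exists_infDist_eq_dist hne x
  exact ⟨w, hw, by rw [h, dist_eq_norm]⟩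

theorem self_mem_projector {Ω : Set X} {x : X} (h : x ∈ Ω) : x ∈ projector Ω x :=
  ⟨h, by rw [sub_self, norm_zero, Metric.infDist_zero_of_mem h]⟩

theorem norm_sub_le_of_mem_projector {Ω : Set X} {x w v : X} (hw : w ∈ projector Ω x)
    (hv : v ∈ Ω) : ‖x - w‖ ≤ ‖x - v‖ := by
  rw [hw.2, ← dist_eq_norm]
  exact Metric.infDist_le_dist_of_mem hv

theorem TAP_subset {A B : Set X} (u : X) : TAP A B u ⊆ A := by
  rintro v ⟨w, -, hv⟩
  exact hv.1

end Projector

section Geometry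

variable {E V ι : Type*} [NormedAddCommGroup E] [InnerProductSpace ℝ E]
  [NormedAddCommGroup V] [InnerProductSpace ℝ V] [Fintype ι]

/-- Projections onto a linear subspace are firmly nonexpansive, with equality by Pythagoras. -/
theorem norm_sq_sub_of_mem_projector_submodule {K : Submodule ℝ E} {x y w z : E}
    (hw : w ∈ projector (K : Set E) x) (hz : z ∈ projector (K : Set E) y) :
    ‖x - y‖ ^ 2 = ‖w - z‖ ^ 2 + ‖(x - w) - (y - z)‖ ^ 2 := by
  have key : ∀ x w : E, w ∈ projector (K : Set E) x → ∀ k ∈ K, inner ℝ (x - w) k = 0 := by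
    intro x w hw
    refine (K.norm_eq_iInf_iff_real_inner_eq_zero hw.1).1 ?_
    rw [hw.2, Metric.infDist_eq_iInf]
    simp only [dist_eq_norm]
  have hwz : w - z ∈ K := K.sub_mem hw.1 hz.1
  have h0 : inner ℝ (w - z) ((x - w) - (y - z)) = 0 := by
    rw [real_inner_comm, inner_sub_left, key x w hw _ hwz, key y z hz _ hwz, sub_zero]
  have h1 : x - y = (w - z) + ((x - w) - (y - z)) := by abel
  have h2 := norm_add_sq_real (w - z) ((x - w) - (y - z))
  rw [← h1, h0] at h2
  linarith

/-- Near the sphere of radius `ρ`, the radial projection is almost firmly nonexpansive. With unit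
directions `e`, `f` the cross term between the displacements of the images and of the residuals is
`ρ * ((‖x‖ - ρ) + (‖y‖ - ρ)) * (1 - ⟪e, f⟫)`, which is small relative to `‖e - f‖ ^ 2`. -/
theorem radial_almost_firm {x y : V} {ρ ε η : ℝ} (hρ : 0 < ρ) (hε : 0 < ε)
    (hη : 2 * (1 + ε) * η ≤ ε) (hx0 : x ≠ 0) (hy0 : y ≠ 0)
    (hx : |‖x‖ - ρ| ≤ η * ρ) (hy : |‖y‖ - ρ| ≤ η * ρ) :
    ‖(ρ / ‖x‖) • x - (ρ / ‖y‖) • y‖ ^ 2 +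
      ‖(x - (ρ / ‖x‖) • x) - (y - (ρ / ‖y‖) • y)‖ ^ 2 ≤ (1 + ε) * ‖x - y‖ ^ 2 := by
  have hxn : 0 < ‖x‖ := norm_pos_iff.2 hx0
  have hyn : 0 < ‖y‖ := norm_pos_iff.2 hy0
  set e : V := ‖x‖⁻¹ • x with he
  set f : V := ‖y‖⁻¹ • y with hf
  set s := ‖x‖ with hs
  set t := ‖y‖ with ht
  have he1 : ‖e‖ = 1 := by
    rw [he, norm_smul, Real.norm_of_nonneg (by positivity), ← hs, inv_mul_cancel₀ hxn.ne']
  have hf1 : ‖f‖ = 1 := by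
    rw [hf, norm_smul, Real.norm_of_nonneg (by positivity), ← ht, inv_mul_cancel₀ hyn.ne']
  have hxe : x = s • e := by rw [he, smul_inv_smul₀ hxn.ne']
  have hyf : y = t • f := by rw [hf, smul_inv_smul₀ hyn.ne']
  have hpx : (ρ / s) • x = ρ • e := by rw [he, smul_smul, div_eq_mul_inv]
  have hpy : (ρ / t) • y = ρ • f := by rw [hf, smul_smul, div_eq_mul_inv]
  clear_value e f
  set g : ℝ := inner ℝ e f with hg
  have hg1 : |g| ≤ 1 := by
    have := abs_real_inner_le_norm e f
    rwa [he1, hf1, one_mul] at this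
  have hN : ∀ α β : ℝ, ‖α • e - β • f‖ ^ 2 = α ^ 2 + β ^ 2 - 2 * α * β * g := by
    intro α β
    rw [norm_sub_sq_real, norm_smul, norm_smul, he1, hf1, real_inner_smul_left,
      real_inner_smul_right, mul_one, mul_one, Real.norm_eq_abs, Real.norm_eq_abs, sq_abs, sq_abs]
    ring
  rw [hpx, hpy, hN]
  have hres : (x - ρ • e) - (y - ρ • f) = (s - ρ) • e - (t - ρ) • f := by
    rw [sub_smul, sub_smul, ← hxe, ← hyf]
  have hQ : 0 ≤ ‖(s - ρ) • e - (t - ρ) • f‖ ^ 2 := sq_nonneg _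
  rw [hres]
  rw [show x - y = s • e - t • f by rw [← hxe, ← hyf], hN s t]
  rw [hN] at hQ ⊢
  have hP : 0 ≤ ρ * (1 - g) := mul_nonneg hρ.le (by linarith [(abs_le.1 hg1).2])
  have h1 : 0 ≤ ρ * (1 - g) * ((s - ρ) + (t - ρ) + 2 * (η * ρ)) :=
    mul_nonneg hP (by linarith [(abs_le.1 hx).1, (abs_le.1 hy).1])
  have h2 : 0 ≤ (ρ * (1 - g)) * (ρ * (ε - 2 * (1 + ε) * η)) :=
    mul_nonneg hP (mul_nonneg hρ.le (by linarith))
  have h3 := mul_nonneg (show 0 ≤ 1 + ε by linarith) h1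
  have h4 := mul_nonneg hε.le hQ
  nlinarith

/-- The product of the spheres of radii `‖Φ a i‖`, pulled back by the isometry `Φ`. -/
def sphereProduct (Φ : E ≃ₗᵢ[ℝ] PiLp 2 (fun _ : ι => V)) (a : E) : Set E :=
  {u | ∀ i, ‖Φ u i‖ = ‖Φ a i‖}

theorem self_mem_sphereProduct (Φ : E ≃ₗᵢ[ℝ] PiLp 2 (fun _ : ι => V)) (a : E) :
    a ∈ sphereProduct Φ a := fun _ => rfl

theorem isClosed_sphereProduct (Φ : E ≃ₗᵢ[ℝ] PiLp 2 (fun _ : ι => V)) (a : E) :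
    IsClosed (sphereProduct Φ a) := by
  have : sphereProduct Φ a = ⋂ i, {u | ‖Φ u i‖ = ‖Φ a i‖} := by
    ext u; simp [sphereProduct]
  rw [this]
  refine isClosed_iInter fun i => isClosed_eq ?_ continuous_const
  exact ((PiLp.continuous_apply 2 (fun _ : ι => V) i).comp Φ.continuous).norm

theorem norm_sq_eq_sum_apply (Φ : E ≃ₗᵢ[ℝ] PiLp 2 (fun _ : ι => V)) (u : E) :
    ‖u‖ ^ 2 = ∑ i, ‖Φ u i‖ ^ 2 := by
  rw [← Φ.norm_map u, PiLp.norm_sq_eq_of_L2]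

/-- In every block off the centre the projection onto a product of spheres is the radial one: the
squared distance splits into blocks, each bounded below by the distance to its own sphere. -/
theorem apply_of_mem_projector_sphereProduct (Φ : E ≃ₗᵢ[ℝ] PiLp 2 (fun _ : ι => V)) {a u b : E}
    (hu : ∀ i, Φ u i ≠ 0) (hb : b ∈ projector (sphereProduct Φ a) u) (i : ι) :
    Φ b i = (‖Φ a i‖ / ‖Φ u i‖) • Φ u i := by
  set w : E := Φ.symm (WithLp.toLp 2 fun i => (‖Φ a i‖ / ‖Φ u i‖) • Φ u i) with hw
  have hwi : ∀ i, Φ w i = (‖Φ a i‖ / ‖Φ u i‖) • Φ u i := by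
    intro i; rw [hw, Φ.apply_symm_apply]
  have hupos : ∀ i, 0 < ‖Φ u i‖ := fun i => norm_pos_iff.2 (hu i)
  have hwB : w ∈ sphereProduct Φ a := by
    intro i
    rw [hwi, norm_smul, Real.norm_of_nonneg (by positivity), div_mul_cancel₀ _ (hupos i).ne']
  have hdist : ∀ i, ‖Φ (u - w) i‖ = |‖Φ u i‖ - ‖Φ a i‖| := by
    intro i
    rw [map_sub, PiLp.sub_apply, hwi]
    have : Φ u i - (‖Φ a i‖ / ‖Φ u i‖) • Φ u i = (1 - ‖Φ a i‖ / ‖Φ u i‖) • Φ u i := by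
      rw [sub_smul, one_smul]
    rw [this, norm_smul, Real.norm_eq_abs, ← abs_of_pos (hupos i), ← abs_mul, abs_of_pos (hupos i),
      sub_mul, one_mul, div_mul_cancel₀ _ (hupos i).ne']
  have hle : ∀ i ∈ Finset.univ, ‖Φ (u - w) i‖ ^ 2 ≤ ‖Φ (u - b) i‖ ^ 2 := by
    intro i _
    rw [hdist, map_sub, PiLp.sub_apply, ← hb.1 i]
    exact pow_le_pow_left₀ (abs_nonneg _) (abs_norm_sub_norm_le _ _) 2
  have hsum : ∑ i, ‖Φ (u - w) i‖ ^ 2 = ∑ i, ‖Φ (u - b) i‖ ^ 2 := by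
    refine le_antisymm (Finset.sum_le_sum hle) ?_
    rw [← norm_sq_eq_sum_apply, ← norm_sq_eq_sum_apply]
    exact pow_le_pow_left₀ (norm_nonneg _) (norm_sub_le_of_mem_projector hb hwB) 2
  have heq := (Finset.sum_eq_sum_iff_of_le hle).1 hsum i (Finset.mem_univ i)
  rw [hdist, map_sub, PiLp.sub_apply, ← hb.1 i,
    pow_left_inj₀ (abs_nonneg _) (norm_nonneg _) two_ne_zero] at heq
  have hray := (sameRay_iff_norm_sub.2 heq.symm).norm_smul_eq
  rw [← hb.1 i, div_eq_inv_mul, mul_smul, ← hray, inv_smul_smul₀ (hupos i).ne']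

/-- Alternating projections between a subspace and a product of nondegenerate spheres are almost
averaged near a common point. -/
theorem exists_almostAveragedOn_TAP (K : Submodule ℝ E) (Φ : E ≃ₗᵢ[ℝ] PiLp 2 (fun _ : ι => V))
    {a : E} (ha : ∀ i, Φ a i ≠ 0) {ε : ℝ} (hε : 0 < ε) :
    ∃ δ > 0, AlmostAveragedOn (TAP (K : Set E) (sphereProduct Φ a)) (Metric.ball a δ) ε (2 / 3) := by
  set η : ℝ := ε / (2 * (1 + ε)) with hη
  have hη0 : 0 < η := by positivity
  have hη1 : 2 * (1 + ε) * η ≤ ε := by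
    rw [hη, mul_div_cancel₀ _ (by positivity)]
  have hcont : ∀ i, Continuous fun u => Φ u i := fun i =>
    (PiLp.continuous_apply 2 (fun _ : ι => V) i).comp Φ.continuous
  have hev : ∀ᶠ u in 𝓝 a, ∀ i, Φ u i ≠ 0 ∧ |‖Φ u i‖ - ‖Φ a i‖| ≤ η * ‖Φ a i‖ := by
    rw [Filter.eventually_all]
    intro i
    have hpos : 0 < η * ‖Φ a i‖ := mul_pos hη0 (norm_pos_iff.2 (ha i))
    have h1 : Filter.Tendsto (fun u => |‖Φ u i‖ - ‖Φ a i‖|) (𝓝 a) (𝓝 0) := by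
      have : Continuous fun u => |‖Φ u i‖ - ‖Φ a i‖| := ((hcont i).norm.sub continuous_const).abs
      simpa using this.tendsto a
    exact ((hcont i).continuousAt.eventually_ne (ha i)).and
      ((h1.eventually_lt_const hpos).mono fun u hu => hu.le)
  obtain ⟨δ, hδ, hball⟩ := Metric.eventually_nhds_iff_ball.1 hev
  refine ⟨δ, hδ, ?_⟩
  rintro y hy y' ⟨v, hv, hy'⟩ z hz z' ⟨w, hw, hz'⟩
  have hfirm : ‖w - v‖ ^ 2 + ‖(z - w) - (y - v)‖ ^ 2 ≤ (1 + ε) * ‖z - y‖ ^ 2 := by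
    rw [norm_sq_eq_sum_apply Φ (w - v), norm_sq_eq_sum_apply Φ (z - y),
      norm_sq_eq_sum_apply Φ ((z - w) - (y - v)), ← Finset.sum_add_distrib, Finset.mul_sum]
    refine Finset.sum_le_sum fun i _ => ?_
    simp only [map_sub, PiLp.sub_apply]
    rw [apply_of_mem_projector_sphereProduct Φ (fun i => (hball z hz i).1) hw i,
      apply_of_mem_projector_sphereProduct Φ (fun i => (hball y hy i).1) hv i]
    exact radial_almost_firm (norm_pos_iff.2 (ha i)) hε hη1 (hball z hz i).1 (hball y hy i).1
      (hball z hz i).2 (hball y hy i).2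
  have hlin := norm_sq_sub_of_mem_projector_submodule hz' hy'
  have hpar : ‖(z' - z) - (y' - y)‖ ^ 2 ≤
      2 * ‖(z - w) - (y - v)‖ ^ 2 + 2 * ‖(w - z') - (v - y')‖ ^ 2 := by
    have h1 : (z' - z) - (y' - y) = -(((z - w) - (y - v)) + ((w - z') - (v - y'))) := by abel
    have h2 := parallelogram_law_with_norm ℝ ((z - w) - (y - v)) ((w - z') - (v - y'))
    rw [h1, norm_neg]
    nlinarith [mul_self_nonneg ‖(z - w) - (y - v) - ((w - z') - (v - y'))‖]
  linarith

/-- Points `(1 + t) • a` of the ray through a common point `a` are projected back onto `a`. -/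
theorem mem_TAP_ray [ProperSpace E] (K : Submodule ℝ E) (Φ : E ≃ₗᵢ[ℝ] PiLp 2 (fun _ : ι => V))
    {a : E} (ha : ∀ i, Φ a i ≠ 0) (haK : a ∈ K) {t : ℝ} (ht : 0 < t) :
    a ∈ TAP (K : Set E) (sphereProduct Φ a) ((1 + t) • a) := by
  have h1 : 0 < 1 + t := by linarith
  obtain ⟨b, hb⟩ := projector_nonempty (isClosed_sphereProduct Φ a)
    ⟨a, self_mem_sphereProduct Φ a⟩ ((1 + t) • a)
  have hba : b = a := by
    apply Φ.injective
    ext1 i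
    have hi : Φ ((1 + t) • a) i = (1 + t) • Φ a i := by rw [map_smul, PiLp.smul_apply]
    have hn : 0 < ‖Φ a i‖ := norm_pos_iff.2 (ha i)
    rw [apply_of_mem_projector_sphereProduct Φ (fun j => by
      rw [map_smul, PiLp.smul_apply]; exact smul_ne_zero h1.ne' (ha j)) hb i, hi, norm_smul,
      Real.norm_of_nonneg h1.le, smul_smul]
    rw [show ‖Φ a i‖ / ((1 + t) * ‖Φ a i‖) * (1 + t) = 1 by field_simp, one_smul]
  rw [hba] at hb
  exact ⟨a, hb, self_mem_projector haK⟩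

end Geometry

/-! ### The imaging model as a subspace and a product of spheres -/

section Model

variable {m n : ℕ}

/-- The characters of `ℤ/n`, in the exponential form of the Fourier kernel, are orthogonal. -/
theorem sum_fourier_kernel (hn : 1 ≤ n) (a b : Fin n) :
    ∑ k : Fin n, starRingEnd ℂ (Complex.exp (-(2 * Real.pi * Complex.I * ((a : ℂ) * (k : ℂ)) / n))) *
      Complex.exp (-(2 * Real.pi * Complex.I * ((b : ℂ) * (k : ℂ)) / n)) =
      if a = b then (n : ℂ) else 0 := by
  have hn0 : (n : ℂ) ≠ 0 := by exact_mod_cast (by omega : n ≠ 0)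
  set z : ℂ := Complex.exp (2 * Real.pi * Complex.I * ((a : ℂ) - b) / n) with hz
  have hterm : ∀ k : Fin n,
      starRingEnd ℂ (Complex.exp (-(2 * Real.pi * Complex.I * ((a : ℂ) * (k : ℂ)) / n))) *
      Complex.exp (-(2 * Real.pi * Complex.I * ((b : ℂ) * (k : ℂ)) / n)) = z ^ (k : ℕ) := by
    intro k
    rw [← Complex.exp_conj, ← Complex.exp_add, hz, ← Complex.exp_nat_mul]
    congr 1
    simp only [map_neg, map_div₀, map_mul, map_ofNat, Complex.conj_ofReal, Complex.conj_I,
      map_natCast]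
    ring
  rw [Finset.sum_congr rfl fun k _ => hterm k, Fin.sum_univ_eq_sum_range (fun k => z ^ k) n]
  split_ifs with hab
  · have : z = 1 := by rw [hz, hab]; simp
    simp [this]
  · have hzn : z ^ n = 1 := by
      rw [hz, ← Complex.exp_nat_mul, Complex.exp_eq_one_iff]
      refine ⟨(a : ℤ) - (b : ℤ), ?_⟩
      push_cast
      field_simp
    have hz1 : z ≠ 1 := by
      intro h
      rw [hz, Complex.exp_eq_one_iff] at h
      obtain ⟨N, hN⟩ := h
      have h2 : ((a : ℂ) - b) = N * n := by
        have h3 : (2 * Real.pi * Complex.I : ℂ) ≠ 0 := Complex.two_pi_I_ne_zero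
        rw [div_eq_iff hn0] at hN
        apply mul_left_cancel₀ h3
        linear_combination hN
      have h4 : ((a : ℕ) : ℤ) - ((b : ℕ) : ℤ) = N * n := by exact_mod_cast h2
      have ha := a.2
      have hb := b.2
      have h5 : |N * (n : ℤ)| < n := by
        rw [← h4, abs_lt]; omega
      have h6 : N = 0 := by
        by_contra hN0
        rw [abs_mul, Nat.abs_cast] at h5
        have : 1 ≤ |N| := Int.one_le_abs hN0
        nlinarith
      rw [h6, zero_mul] at h4
      exact hab (Fin.ext (by omega))
    have := mul_geom_sum z n
    rw [hzn, sub_self] at this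
    exact (mul_eq_zero.1 this).resolve_left (sub_ne_zero.2 hz1)

/-- The image, under phase modulation by `φ` followed by the Fourier transform, of the unit array
supported at the pixel `ξ`. -/
noncomputable def phaseFourierVec (φ : Pixel n → ℝ) (ξ : Pixel n) : Img n :=
  WithLp.toLp 2 fun η => (1 / (n : ℂ)) * (Complex.exp (Complex.I * φ ξ) *
    Complex.exp (-(2 * Real.pi * Complex.I *
      ((ξ.1 : ℂ) * (η.1 : ℂ) + (ξ.2 : ℂ) * (η.2 : ℂ)) / n)))

theorem orthonormal_phaseFourierVec (hn : 1 ≤ n) (φ : Pixel n → ℝ) :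
    Orthonormal ℂ (phaseFourierVec φ) := by
  have hn0 : (n : ℂ) ≠ 0 := by exact_mod_cast (by omega : n ≠ 0)
  rw [orthonormal_iff_ite]
  intro ξ ζ
  set e : Fin n → Fin n → ℂ := fun a k =>
    Complex.exp (-(2 * Real.pi * Complex.I * ((a : ℂ) * (k : ℂ)) / n)) with he
  have hsplit : ∀ (ξ η : Pixel n), phaseFourierVec φ ξ η =
      (1 / (n : ℂ)) * (Complex.exp (Complex.I * φ ξ) * (e ξ.1 η.1 * e ξ.2 η.2)) := by
    intro ξ η
    simp only [phaseFourierVec, he]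
    rw [← Complex.exp_add (-_)]
    congr 3
    ring
  have hphase : ξ = ζ → starRingEnd ℂ (Complex.exp (Complex.I * φ ξ)) *
      Complex.exp (Complex.I * φ ζ) = 1 := by
    rintro rfl
    rw [← Complex.exp_conj, ← Complex.exp_add]
    simp
  have hinner : inner ℂ (phaseFourierVec φ ξ) (phaseFourierVec φ ζ) =
      (1 / (n : ℂ)) ^ 2 * (starRingEnd ℂ (Complex.exp (Complex.I * φ ξ)) *
        Complex.exp (Complex.I * φ ζ)) * ((∑ k, starRingEnd ℂ (e ξ.1 k) * e ζ.1 k) *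
        ∑ k, starRingEnd ℂ (e ξ.2 k) * e ζ.2 k) := by
    rw [PiLp.inner_apply, Fintype.sum_mul_sum, ← Fintype.sum_prod_type', Finset.mul_sum]
    refine Finset.sum_congr rfl fun η _ => ?_
    rw [RCLike.inner_apply, hsplit, hsplit]
    simp only [map_mul, map_div₀, map_one, map_natCast]
    ring
  rw [hinner, sum_fourier_kernel hn, sum_fourier_kernel hn]
  by_cases h : ξ = ζ
  · rw [hphase h, h]
    simp only [if_true]
    field_simp
  · rw [if_neg h]
    rcases not_and_or.1 (mt Prod.ext_iff.2 h) with h1 | h1 <;> simp [h1]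

/-- Phase modulation followed by the Fourier transform, as a linear isometry of `ℂ^{n×n}`. -/
noncomputable def phaseFourierIso (hn : 1 ≤ n) (φ : Pixel n → ℝ) : Img n ≃ₗᵢ[ℂ] Img n :=
  haveI : Nonempty (Pixel n) := ⟨(⟨0, hn⟩, ⟨0, hn⟩)⟩
  ((basisOfOrthonormalOfCardEqFinrank (orthonormal_phaseFourierVec hn φ)
    finrank_euclideanSpace.symm).toOrthonormalBasis (by
      rw [coe_basisOfOrthonormalOfCardEqFinrank]; exact orthonormal_phaseFourierVec hn φ)).repr.symm

theorem phaseFourierIso_apply (hn : 1 ≤ n) (φ : Pixel n → ℝ) (x : HSpace n) (c : Component) :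
    phaseFourierIso hn φ (x c) = phaseFourier φ x c := by
  rw [phaseFourierIso, ← OrthonormalBasis.sum_repr_symm]
  simp only [Module.Basis.coe_toOrthonormalBasis, coe_basisOfOrthonormalOfCardEqFinrank]
  ext η
  simp only [phaseFourier, dft2, phaseFourierVec, WithLp.ofLp_sum, WithLp.ofLp_smul,
    Finset.sum_apply, Pi.smul_apply, smul_eq_mul, Finset.mul_sum]
  refine Finset.sum_congr rfl fun ξ _ => ?_
  ring

/-- All phase-diverse Fourier transforms together, with the coordinates regrouped so that the block
of an image plane `d` and a pixel `ξ` holds the six components at `ξ`. -/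
noncomputable def measurementIso (hn : 1 ≤ n) (φ : Fin m → Pixel n → ℝ) :
    HProd m n ≃ₗᵢ[ℝ] PiLp 2 (fun _ : Fin m × Pixel n => EuclideanSpace ℂ Component) where
  toFun u := WithLp.toLp 2 fun i => WithLp.toLp 2 fun c => phaseFourierIso hn (φ i.1) (u i.1 c) i.2
  invFun w := WithLp.toLp 2 fun d => WithLp.toLp 2 fun c =>
    (phaseFourierIso hn (φ d)).symm (WithLp.toLp 2 fun ξ => w (d, ξ) c)
  map_add' u v := by
    ext i c
    simp
  map_smul' t u := by
    ext i c
    have h := congrArg (fun w : Img n => w i.2)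
      (map_smul (phaseFourierIso hn (φ i.1)) (t : ℂ) (u i.1 c))
    simpa using h
  left_inv u := by
    ext d c ξ
    simp
  right_inv w := by
    ext i c
    simp
  norm_map' u := by
    rw [← sq_eq_sq₀ (norm_nonneg _) (norm_nonneg _)]
    simp only [PiLp.norm_sq_eq_of_L2]
    rw [Fintype.sum_prod_type]
    refine Finset.sum_congr rfl fun d _ => ?_
    rw [Finset.sum_comm]
    refine Finset.sum_congr rfl fun c _ => ?_
    have h := congrArg (· ^ 2) ((phaseFourierIso hn (φ d)).norm_map (u d c))
    simp only [PiLp.norm_sq_eq_of_L2] at h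
    exact h

theorem norm_sq_measurementIso (hn : 1 ≤ n) (φ : Fin m → Pixel n → ℝ) (u : HProd m n)
    (i : Fin m × Pixel n) :
    ‖measurementIso hn φ u i‖ ^ 2 = ∑ c, ‖phaseFourier (φ i.1) (u i.1) c i.2‖ ^ 2 := by
  rw [PiLp.norm_sq_eq_of_L2]
  refine Finset.sum_congr rfl fun c _ => ?_
  rw [← phaseFourierIso_apply hn]
  rfl

/-- The set `A` of the imaging model, as a real linear subspace. -/
def subspaceA (m : ℕ) (E : Component → Pixel n → ℝ) : Submodule ℝ (HProd m n) where
  carrier := setA m E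
  add_mem' := by
    rintro _ _ ⟨_, ⟨z, rfl⟩, rfl⟩ ⟨_, ⟨w, rfl⟩, rfl⟩
    refine ⟨_, ⟨z + w, rfl⟩, ?_⟩
    ext d c ξ
    simp [dup, mul_add]
  zero_mem' := by
    refine ⟨_, ⟨0, rfl⟩, ?_⟩
    ext d c ξ
    simp [dup]
  smul_mem' := by
    rintro t _ ⟨_, ⟨z, rfl⟩, rfl⟩
    refine ⟨_, ⟨t • z, rfl⟩, ?_⟩
    ext d c ξ
    simp only [dup, PiLp.smul_apply, Complex.real_smul]
    ring

theorem setB_eq_sphereProduct (hn : 1 ≤ n) {φ r : Fin m → Pixel n → ℝ} {a : HProd m n}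
    (ha : a ∈ setB φ r) : setB φ r = sphereProduct (measurementIso hn φ) a := by
  ext u
  have key : ∀ d ξ, ‖measurementIso hn φ u (d, ξ)‖ = ‖measurementIso hn φ a (d, ξ)‖ ↔
      ∑ c, ‖phaseFourier (φ d) (u d) c ξ‖ ^ 2 = r d ξ := by
    intro d ξ
    rw [← sq_eq_sq₀ (norm_nonneg _) (norm_nonneg _), norm_sq_measurementIso,
      norm_sq_measurementIso, ha d ξ]
  exact ⟨fun h i => (key i.1 i.2).2 (h i.1 i.2), fun h d ξ => (key d ξ).1 (h (d, ξ))⟩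

end Model

end HighNA

/-! ### Alternating projections for the imaging model -/

theorem mainTheorem2 (m n : ℕ) (hm : 1 ≤ m) (hn : 1 ≤ n)
    (kX kY kZ : HighNA.Pixel n → ℝ)
    (hk : ∀ ξ, kX ξ ^ 2 + kY ξ ^ 2 + kZ ξ ^ 2 = 1) (hkZ : ∀ ξ, 1 + kZ ξ ≠ 0)
    (φ r : Fin m → HighNA.Pixel n → ℝ)
    (A B : Set (HighNA.HProd m n))
    (hA : A = HighNA.setA m (HighNA.modulation kX kY kZ)) (hB : B = HighNA.setB φ r)
    (xhat : HighNA.HSpace n) (hx : HighNA.dup m xhat ∈ A ∩ B)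
    (hG : ∀ d ξ, HighNA.gMag (φ d) xhat ξ ≠ 0)
    (ε : ℝ) (hε : 0 < ε) :
    ∃ δ > 0,
      HighNA.AlmostAveragedOn (HighNA.TAP A B) (Metric.ball (HighNA.dup m xhat) δ) ε (2 / 3) ∧
      ∀ κ : ℝ, Real.sqrt (2 * ε) < κ →
        HighNA.MetricallySubregularAt (HighNA.idSub (HighNA.TAP A B))
          (HighNA.dup m xhat) 0 A κ →
        Real.sqrt (1 + ε - κ ^ 2 / 2) < 1 ∧
        ∀ x : ℕ → HighNA.HProd m n, HighNA.IsIterativeSequence (HighNA.TAP A B) x →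
          x 0 ∈ A ∩ Metric.ball (HighNA.dup m xhat) δ →
          ∃ p ∈ HighNA.fixSet (HighNA.TAP A B),
            HighNA.ConvergesLinearly x p (Real.sqrt (1 + ε - κ ^ 2 / 2)) := by
  set a : HighNA.HProd m n := HighNA.dup m xhat with ha
  set K := HighNA.subspaceA m (HighNA.modulation kX kY kZ) with hK
  set Φ := HighNA.measurementIso hn φ with hΦ
  have hAK : A = (K : Set (HighNA.HProd m n)) := hA
  have hBΦ : B = HighNA.sphereProduct Φ a := by
    rw [hB] at hx ⊢
    exact HighNA.setB_eq_sphereProduct hn hx.2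
  have haK : a ∈ K := by
    have := hx.1
    rwa [hAK] at this
  have hΦa : ∀ i, Φ a i ≠ 0 := by
    intro i h0
    have h1 := HighNA.norm_sq_measurementIso hn φ a i
    rw [← hΦ, h0, norm_zero, zero_pow two_ne_zero] at h1
    apply hG i.1 i.2
    rw [HighNA.gMag, Real.sqrt_eq_zero']
    exact h1.symm.le
  have ha0 : a ≠ 0 := by
    intro h
    apply hΦa (⟨0, hm⟩, (⟨0, hn⟩, ⟨0, hn⟩))
    rw [h, map_zero]
    rfl
  rw [hAK, hBΦ]
  refine HighNA.exists_uniform_ball_linear_convergence (fun x => ?_) HighNA.TAP_subset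
    (fun η hη => HighNA.exists_almostAveragedOn_TAP K Φ hΦa hη) ha0
    (fun t ht => ⟨K.smul_mem _ haK, HighNA.mem_TAP_ray K Φ hΦa haK ht⟩) hε
  obtain ⟨b, hb⟩ := HighNA.projector_nonempty (HighNA.isClosed_sphereProduct Φ a)
    ⟨a, HighNA.self_mem_sphereProduct Φ a⟩ x
  obtain ⟨v, hv⟩ := HighNA.projector_nonempty K.closed_of_finiteDimensional ⟨a, haK⟩ b
  exact ⟨v, b, hb, hv⟩
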